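/- For every $m\in\mathbb N$ let $p_{1,m},\dots,p_{m,m}\in[0,1]$ be $p$-values on a probability space $(\Omega_m,\mathcal A_m,P_m)$ and let $\{1,\dots,m\}=I_{0,m}\cup I_{1,m}$ be a nonrandom disjoint decomposition into true nulls $I_{0,m}$ and false nulls $I_{1,m}$, with $m_0=\#I_{0,m}\ge 1$ and $m_1=\#I_{1,m}$. Assume that the vectors $(p_{i,m})_{i\in I_{0,m}}$ and $(p_{i,m})_{i\in I_{1,m}}$ are independent and that the $p_{i,m}$, $i\in I_{0,m}$, are i.i.d. uniformly distributed on $[0,1]$ (the joint distribution of the $p_{i,m}$, $i\in I_{1,m}$, is arbitrary). Let $0<\alpha<1$ and $\alpha\le\lambda<1$ be fixed, let $\widehat F_m$ be the empirical distribution function of $p_{1,m},\dots,p_{m,m}$ and $R_m(\lambda)=m\widehat F_m(\lambda)$, and let $\widehat m_0=\widehat m_0((\widehat F_m(t))_{t\ge\lambda})>0$ be an estimator that is a measurable function (which may depend on $m$) of $(\widehat F_m(t))_{t\ge\lambda}$. Consider the adaptive step-up test with critical values $\widehat\alpha_{i:m}=\min\{\tfrac{i}{\widehat m_0}\alpha,\lambda\}$,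 $0\le i\le m$: with the ordered $p$-values $p_{1:m}\le\dots\le p_{m:m}$ and $p_{0:m}:=0$, put $R_m=\max\{i\in\{0,\dots,m\}:p_{i:m}\le\widehat\alpha_{i:m}\}$, reject the $i$-th null hypothesis iff $p_{i,m}\le\widehat\alpha_{R_m:m}$, and let $V_m=\#\{i\in I_{0,m}:p_{i,m}\le\widehat\alpha_{R_m:m}\}$ be the number of false rejections. Let $\mathrm{FDR}_m=E(V_m/R_m)$, with $0/0=0$. The sequence of tests is called consistent if $V_m/R_m-E(V_m/R_m)\to0$ in $P_m$-probability as $m\to\infty$. Suppose that $\liminf_{m\to\infty}\mathrm{FDR}_m>0$ and that there is a constant $C>1$ with $$\lim_{m\to\infty}P_m\Bigl(\widehat m_0\ge\frac{C\alpha}{\lambda}\,(R_m(\lambda)\vee1)\Bigr)=1 .$$ Then the following hold. (a) If the sequence of tests is consistent, then $m_1\to\infty$. (b) If $m_0/m\to\kappa_0$ for some $\kappa_0\in(0,1]$, and if for every $m$ the false-null $p$-values $(p_{i,m})_{i\in I_{1,m}}$ are i.i.d. uniformly distributed on $[0,\lambda]$, then the sequence of tests is not consistent. -/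

import Mathlib

open MeasureTheory ProbabilityTheory Filter Topology

namespace AdaptiveStepUp

noncomputable section

/-- The empirical distribution function `t ↦ F̂ₘ(t)` of the p-values `x 0, …, x (m - 1)`. -/
def empCDF {m : ℕ} (x : Fin m → ℝ) (t : ℝ) : ℝ :=
  ((Finset.univ.filter fun i => x i ≤ t).card : ℝ) / m

/-- `Rₘ(t) = m F̂ₘ(t)`, the number of p-values that are at most `t`. -/
def countLE {m : ℕ} (x : Fin m → ℝ) (t : ℝ) : ℝ := m * empCDF x t

/-- The order statistic `p_{i:m}` for `1 ≤ i ≤ m` (the `i`-th smallest p-value), with `p_{0:m} = 0`.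
Indices above `m` are never used. -/
def orderStat {m : ℕ} (x : Fin m → ℝ) (i : ℕ) : ℝ :=
  if h : 1 ≤ i ∧ i ≤ m then x (Tuple.sort x ⟨i - 1, by omega⟩) else 0

/-- The value of an estimator of `m₀` that is a function `g` of `(F̂ₘ(t))_{t ≥ lam}`. -/
def estimate {m : ℕ} (lam : ℝ) (g : (Set.Ici lam → ℝ) → ℝ) (x : Fin m → ℝ) : ℝ :=
  g fun t => empCDF x t

/-- The data dependent critical values `α̂_{i:m} = min {(i / m̂₀) α, lam}`. -/
def critVal {m : ℕ} (α lam : ℝ) (g : (Set.Ici lam → ℝ) → ℝ) (x : Fin m → ℝ) (i : ℕ) : ℝ :=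
  min ((i : ℝ) / estimate lam g x * α) lam

/-- The number of rejections `Rₘ = max {i = 0, …, m : p_{i:m} ≤ α̂_{i:m}}`. -/
def numRej {m : ℕ} (α lam : ℝ) (g : (Set.Ici lam → ℝ) → ℝ) (x : Fin m → ℝ) : ℕ :=
  Nat.findGreatest (fun i => orderStat x i ≤ critVal α lam g x i) m

/-- The number `Vₘ` of falsely rejected nulls; the `i`-th null hypothesis is rejected iff
`p_i ≤ α̂_{Rₘ:m}`, and `I₀` is the set of true nulls. -/
def numFalseRej {m : ℕ} (α lam : ℝ) (g : (Set.Ici lam → ℝ) → ℝ) (I₀ : Finset (Fin m))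
    (x : Fin m → ℝ) : ℕ :=
  (I₀.filter fun i => x i ≤ critVal α lam g x (numRej α lam g x)).card

/-- The false discovery proportion `Vₘ / Rₘ`, with `0 / 0 = 0`. -/
def fdp {m : ℕ} (α lam : ℝ) (g : (Set.Ici lam → ℝ) → ℝ) (I₀ : Finset (Fin m))
    (x : Fin m → ℝ) : ℝ :=
  (numFalseRej α lam g I₀ x : ℝ) / (numRej α lam g x : ℝ)

/-- The false discovery rate, the expectation of the false discovery proportion. -/
def fdr {m : ℕ} {Ω : Type*} [MeasurableSpace Ω] (P : Measure Ω) (p : Fin m → Ω → ℝ)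
    (α lam : ℝ) (g : (Set.Ici lam → ℝ) → ℝ) (I₀ : Finset (Fin m)) : ℝ :=
  ∫ ω, fdp α lam g I₀ (fun i => p i ω) ∂P

/-- The basic independence model with true nulls `I₀` and false nulls `I₀ᶜ`. -/
structure BasicIndependence {m : ℕ} {Ω : Type*} [MeasurableSpace Ω] (P : Measure Ω)
    (p : Fin m → Ω → ℝ) (I₀ : Finset (Fin m)) : Prop where
  measurable : ∀ i, Measurable (p i)
  mem_Icc : ∀ i ω, p i ω ∈ Set.Icc (0 : ℝ) 1
  /-- The vector of true null p-values is independent of the vector of false null p-values. -/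
  indep_true_false : IndepFun (fun ω (i : {i // i ∈ I₀}) => p i ω)
    (fun ω (i : {i // i ∈ I₀ᶜ}) => p i ω) P
  /-- The true null p-values are independent. -/
  indep_true : iIndepFun (fun (i : {i // i ∈ I₀}) => p i) P
  /-- The true null p-values are uniformly distributed on `[0, 1]`. -/
  uniform_true : ∀ i ∈ I₀, pdf.IsUniform (p i) (Set.Icc 0 1) P volume

/-- Consistency of a sequence of tests: `FDPₘ - E(FDPₘ) → 0` in `Pₘ`-probability. -/
def Consistent {Ω : ℕ → Type*} [∀ m, MeasurableSpace (Ω m)] (P : ∀ m, Measure (Ω m))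
    (p : ∀ m, Fin m → Ω m → ℝ) (α lam : ℝ) (g : ℕ → (Set.Ici lam → ℝ) → ℝ)
    (I₀ : ∀ m, Finset (Fin m)) : Prop :=
  ∀ ε : ℝ, 0 < ε → Tendsto (fun m => P m {ω | ε ≤
    |fdp α lam (g m) (I₀ m) (fun i => p m i ω) - fdr (P m) (p m) α lam (g m) (I₀ m)|})
    atTop (𝓝 0)

end

end AdaptiveStepUp

open AdaptiveStepUp

/-!
If no true null is rejected then the false discovery proportion vanishes, so consistency together
with a non-vanishing FDR forces `P (V = 0) → 0`. A leave-one-out argument bounds `P (V = 0)` from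
below. When the estimator is at least `(C α / λ) (R(λ) ∨ 1)`, the rejection boundary `r α / m̂₀` has
so small a slope that at most `(λ / C)(m̂₀ / α)` p-values lie in `(0, λ]`. Each of them, if uniform
there and independent of the others, falls below the boundary computed without it with probability
proportional to that boundary. Weighting by the inverse number of p-values below the boundary and
summing gives rejection probability at most `1 / C < 1`. This settles (b), where all p-values are
uniform on `(0, λ]` when they lie there.

For (a), at most `k` false nulls raise the boundary by at most `a = 2 k / m₀`, because
`m̂₀ ≥ α m₀ / 2` up to an event of vanishing probability. On the event that no true-null p-value is
at most `a`, whose probability `(1 - a) ^ m₀` tends to `exp (-2 k) > 0`, the argument applies on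
`(a, λ]`, with the false nulls counted in any case.
-/

namespace AdaptiveStepUp

open Set Function ENNReal

section Crossing

variable {ι : Type*}

/-- The number of coordinates of `x` with index in `I` and value in `(a, t]`. -/
noncomputable def countIoc (I : Finset ι) (a t : ℝ) (x : ι → ℝ) : ℕ :=
  (I.filter fun i => x i ∈ Ioc a t).card

/-- The last index `r ≤ M` at which the linear boundary `r ↦ r * b` is still below `l` and at least
`r` values are counted: the coordinates in `I` with value in `(a, r * b]`, and `s` further values
that are always counted. The index `0` qualifies as soon as `0 ≤ l`. -/
noncomputable def lastCrossing (I : Finset ι) (a l b : ℝ) (s M : ℕ) (x : ι → ℝ) : ℕ :=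
  Nat.findGreatest (fun r => r * b ≤ l ∧ r ≤ s + countIoc I a (r * b) x) M

/-- `f` does not see the exact value of the `i`-th coordinate in `(a, l]`: raising it to `l` changes
nothing. -/
def RaiseInvariant [DecidableEq ι] {β : Type*} (i : ι) (a l : ℝ) (f : (ι → ℝ) → β) : Prop :=
  ∀ x, x i ∈ Ioc a l → f (update x i l) = f x

variable {I : Finset ι} {a l b : ℝ} {s M : ℕ} {x : ι → ℝ} {i : ι}

lemma countIoc_mono {t u : ℝ} (h : t ≤ u) : countIoc I a t x ≤ countIoc I a u x :=
  Finset.card_le_card (Finset.monotone_filter_right _ fun _ _ hi => Ioc_subset_Ioc_right h hi)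

lemma countIoc_erase_add_one [DecidableEq ι] {t : ℝ} (hi : i ∈ I) (hx : x i ∈ Ioc a t) :
    countIoc (I.erase i) a t x + 1 = countIoc I a t x := by
  unfold countIoc
  rw [Finset.filter_erase, Finset.card_erase_add_one (Finset.mem_filter.2 ⟨hi, hx⟩)]

lemma countIoc_erase_update [DecidableEq ι] (c t : ℝ) :
    countIoc (I.erase i) a t (update x i c) = countIoc (I.erase i) a t x := by
  unfold countIoc
  congr 1
  exact Finset.filter_congr fun j hj => by rw [update_of_ne (Finset.ne_of_mem_erase hj)]

lemma measurable_countIoc {t : (ι → ℝ) → ℝ} (ht : Measurable t) :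
    Measurable fun x => countIoc I a (t x) x := by
  simp only [countIoc, Finset.card_filter]
  refine Finset.measurable_sum _ fun i _ => Measurable.ite ?_ measurable_const measurable_const
  exact (measurableSet_lt measurable_const (measurable_pi_apply i)).inter
    (measurableSet_le (measurable_pi_apply i) ht)

lemma lastCrossing_spec (hl : 0 ≤ l) :
    lastCrossing I a l b s M x * b ≤ l ∧
      lastCrossing I a l b s M x ≤ s + countIoc I a (lastCrossing I a l b s M x * b) x :=
  Nat.findGreatest_spec (P := fun r : ℕ => r * b ≤ l ∧ r ≤ s + countIoc I a (r * b) x)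
    (Nat.zero_le M) (by simp [hl])

lemma le_lastCrossing {r : ℕ} (hrM : r ≤ M) (hrl : r * b ≤ l)
    (hr : r ≤ s + countIoc I a (r * b) x) : r ≤ lastCrossing I a l b s M x :=
  Nat.le_findGreatest hrM ⟨hrl, hr⟩

lemma measurable_lastCrossing {b : (ι → ℝ) → ℝ} {s : (ι → ℝ) → ℕ} (hb : Measurable b)
    (hs : Measurable s) : Measurable fun x => lastCrossing I a l (b x) (s x) M x :=
  measurable_findGreatest fun r _ =>
    (measurableSet_le (hb.const_mul (r : ℝ)) measurable_const).inter
      (measurableSet_le measurable_const (hs.add (measurable_countIoc (hb.const_mul (r : ℝ)))))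

variable [DecidableEq ι]

/-- The last boundary value when coordinate `i` is counted in any case. -/
noncomputable def leaveOneOutThreshold (I : Finset ι) (a l b : ℝ) (s M : ℕ) (i : ι)
    (x : ι → ℝ) : ℝ :=
  lastCrossing (I.erase i) a l b (s + 1) M x * b

/-- The inverse of the number of coordinates in `I` below the leave-one-out threshold of `i`, where
coordinate `i` itself is counted in any case. -/
noncomputable def leaveOneOutWeight (I : Finset ι) (a l b : ℝ) (s M : ℕ) (i : ι)
    (x : ι → ℝ) : ℝ≥0∞ :=
  (countIoc (I.erase i) a (leaveOneOutThreshold I a l b s M i x) x + 1)⁻¹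

lemma leaveOneOutThreshold_le (hl : 0 ≤ l) : leaveOneOutThreshold I a l b s M i x ≤ l :=
  (lastCrossing_spec hl).1

lemma leaveOneOutThreshold_update (c : ℝ) :
    leaveOneOutThreshold I a l b s M i (update x i c) = leaveOneOutThreshold I a l b s M i x := by
  simp only [leaveOneOutThreshold, lastCrossing, countIoc_erase_update]

lemma leaveOneOutWeight_update (c : ℝ) :
    leaveOneOutWeight I a l b s M i (update x i c) = leaveOneOutWeight I a l b s M i x := by
  simp only [leaveOneOutWeight, leaveOneOutThreshold_update, countIoc_erase_update]

lemma measurable_leaveOneOutThreshold {b : (ι → ℝ) → ℝ} {s : (ι → ℝ) → ℕ} (hb : Measurable b)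
    (hs : Measurable s) : Measurable fun x => leaveOneOutThreshold I a l (b x) (s x) M i x :=
  (measurable_from_nat.comp (measurable_lastCrossing hb (hs.add_const 1))).mul hb

lemma measurable_leaveOneOutWeight {b : (ι → ℝ) → ℝ} {s : (ι → ℝ) → ℕ} (hb : Measurable b)
    (hs : Measurable s) : Measurable fun x => leaveOneOutWeight I a l (b x) (s x) M i x :=
  ((measurable_from_nat.comp
    (measurable_countIoc (measurable_leaveOneOutThreshold hb hs))).add_const 1).inv

lemma lastCrossing_erase (hb : 0 ≤ b) (hl : 0 ≤ l) (hi : i ∈ I)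
    (hx : x i ∈ Ioc a (lastCrossing I a l b s M x * b)) :
    lastCrossing (I.erase i) a l b (s + 1) M x = lastCrossing I a l b s M x := by
  have hcount {r : ℕ} (hr : lastCrossing I a l b s M x ≤ r) :
      s + 1 + countIoc (I.erase i) a (r * b) x = s + countIoc I a (r * b) x := by
    have hxr : x i ∈ Ioc a (r * b) := ⟨hx.1, hx.2.trans (by gcongr)⟩
    rw [← countIoc_erase_add_one hi hxr]
    ring
  refine Nat.findGreatest_eq_iff.2 ⟨Nat.findGreatest_le _, fun _ => ?_, fun r hr hrM h => ?_⟩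
  · rw [hcount le_rfl]
    exact lastCrossing_spec hl
  · rw [hcount hr.le] at h
    exact (le_lastCrossing hrM h.1 h.2).not_gt hr

lemma one_le_sum_leaveOneOutWeight (hb : 0 ≤ b) (hl : 0 ≤ l)
    (h : 1 ≤ countIoc I a (lastCrossing I a l b s M x * b) x) :
    1 ≤ ∑ i ∈ I, (Ioc a (leaveOneOutThreshold I a l b s M i x)).indicator
      (fun _ => leaveOneOutWeight I a l b s M i x) (x i) := by
  set t := lastCrossing I a l b s M x * b
  have hterm : ∀ i ∈ I.filter fun i => x i ∈ Ioc a t,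
      (Ioc a (leaveOneOutThreshold I a l b s M i x)).indicator
        (fun _ => leaveOneOutWeight I a l b s M i x) (x i) = (countIoc I a t x : ℝ≥0∞)⁻¹ := by
    intro i hi
    obtain ⟨hiI, hix⟩ := Finset.mem_filter.1 hi
    have hthr : leaveOneOutThreshold I a l b s M i x = t := by
      rw [leaveOneOutThreshold, lastCrossing_erase hb hl hiI hix]
    rw [leaveOneOutWeight, hthr, indicator_of_mem hix, ← countIoc_erase_add_one hiI hix]
    push_cast
    rfl
  calc (1 : ℝ≥0∞) = countIoc I a t x * (countIoc I a t x : ℝ≥0∞)⁻¹ :=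
        (ENNReal.mul_inv_cancel (Nat.cast_ne_zero.2 (by omega)) (natCast_ne_top _)).symm
    _ = ∑ i ∈ I.filter fun i => x i ∈ Ioc a t,
          (Ioc a (leaveOneOutThreshold I a l b s M i x)).indicator
            (fun _ => leaveOneOutWeight I a l b s M i x) (x i) := by
        rw [Finset.sum_congr rfl hterm, Finset.sum_const, nsmul_eq_mul, countIoc]
    _ ≤ _ := Finset.sum_le_sum_of_subset (Finset.filter_subset _ _)

lemma ofReal_leaveOneOutThreshold_mul_weight_le (hb : 0 ≤ b) (hl : 0 ≤ l) (hal : a < l)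
    (hsb : s * b ≤ a) :
    ENNReal.ofReal ((leaveOneOutThreshold I a l b s M i x - a) / (l - a)) *
      leaveOneOutWeight I a l b s M i x ≤ ENNReal.ofReal (b / (l - a)) := by
  have : 0 < l - a := sub_pos.2 hal
  set t := leaveOneOutThreshold I a l b s M i x with ht
  set n := countIoc (I.erase i) a t x
  have hcross : lastCrossing (I.erase i) a l b (s + 1) M x ≤ s + (n + 1) := by
    have := (lastCrossing_spec hl (I := I.erase i) (a := a) (b := b) (s := s + 1) (M := M)
      (x := x)).2
    rwa [add_right_comm, add_assoc] at this
  have htn : t ≤ s * b + (n + 1) * b := by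
    rw [ht, leaveOneOutThreshold, ← add_mul]
    gcongr
    exact_mod_cast hcross
  rw [leaveOneOutWeight, ← div_eq_mul_inv, ENNReal.div_le_iff (by simp) (by finiteness),
    ← Nat.cast_add_one, ← ENNReal.ofReal_natCast, ← ENNReal.ofReal_mul (by positivity),
    div_mul_eq_mul_div]
  gcongr
  push_cast
  linarith

end Crossing

section LeaveOneOut

variable {Ω : Type*} [MeasurableSpace Ω] {P : Measure Ω} [IsProbabilityMeasure P]

lemma lintegral_comp_prodMk_of_indepFun {E F : Type*} [MeasurableSpace E] [MeasurableSpace F]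
    {Y : Ω → E} {Z : Ω → F} (hY : Measurable Y) (hZ : Measurable Z) (h : IndepFun Y Z P)
    {f : E × F → ℝ≥0∞} (hf : Measurable f) :
    ∫⁻ ω, f (Y ω, Z ω) ∂P = ∫⁻ ω, ∫⁻ ω', f (Y ω', Z ω) ∂P ∂P := by
  have := Measure.isProbabilityMeasure_map (μ := P) hY.aemeasurable
  have := Measure.isProbabilityMeasure_map (μ := P) hZ.aemeasurable
  calc ∫⁻ ω, f (Y ω, Z ω) ∂P = ∫⁻ q, f q ∂(P.map Y).prod (P.map Z) := by
        rw [← (indepFun_iff_map_prod_eq_prod_map_map hY.aemeasurable hZ.aemeasurable).1 h,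
          lintegral_map hf (hY.prodMk hZ)]
    _ = ∫⁻ ω, ∫⁻ y, f (y, Z ω) ∂P.map Y ∂P := by
        rw [lintegral_prod_symm' _ hf, lintegral_map hf.lintegral_prod_left' hZ]
    _ = _ := lintegral_congr fun ω => lintegral_map (by fun_prop) hY

variable {ι : Type*} [DecidableEq ι]

/-- Each coordinate of `X` with index in `I` is independent of the other coordinates and, given that
it lies in `(a, l]`, uniformly distributed there. Independence of the other coordinates is expressed
by overwriting coordinate `i` with the constant `l`. -/
structure IndepUniformOnIoc (P : Measure Ω) (X : Ω → ι → ℝ) (I : Finset ι) (a l : ℝ) : Prop where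
  measurable : Measurable X
  indepFun_update : ∀ i ∈ I, IndepFun (fun ω => X ω i) (fun ω => update (X ω) i l) P
  measure_preimage_Ioc : ∀ i ∈ I, ∀ t ∈ Icc a l, P ((fun ω => X ω i) ⁻¹' Ioc a t) =
    ENNReal.ofReal ((t - a) / (l - a)) * P ((fun ω => X ω i) ⁻¹' Ioc a l)

/-- On the event `E`, the random boundary `r ↦ r * b x` with `s x` values counted in any case stays
at most `a` along these values and is flat enough for the leave-one-out bound with constant `ρ`;
neither the boundary nor `E` sees where in `(a, l]` a coordinate with index in `I` lies. -/
structure AdmissibleBoundary (I : Finset ι) (a l ρ : ℝ) (b : (ι → ℝ) → ℝ) (s : (ι → ℝ) → ℕ)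
    (E : Set (ι → ℝ)) : Prop where
  measurable_slope : Measurable b
  measurable_shift : Measurable s
  measurableSet : MeasurableSet E
  slope_raise : ∀ i ∈ I, RaiseInvariant i a l b
  shift_raise : ∀ i ∈ I, RaiseInvariant i a l s
  mem_raise : ∀ i ∈ I, RaiseInvariant i a l (· ∈ E)
  slope_nonneg : ∀ x ∈ E, 0 ≤ b x
  shift_mul_slope_le : ∀ x ∈ E, s x * b x ≤ a
  count_mul_slope_le : ∀ x ∈ E, countIoc I a l x * b x ≤ ρ * (l - a)

variable {X : Ω → ι → ℝ} {I : Finset ι} {a l ρ : ℝ} {b : (ι → ℝ) → ℝ} {s : (ι → ℝ) → ℕ}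
  {E : Set (ι → ℝ)} {i : ι}

lemma IndepUniformOnIoc.lintegral_indicator_Ioc_eq (h : IndepUniformOnIoc P X I a l) (hi : i ∈ I)
    {τ : (ι → ℝ) → ℝ} (hτ : Measurable τ) (hτi : RaiseInvariant i a l τ) (hτl : ∀ x, τ x ≤ l)
    {k : (ι → ℝ) → ℝ≥0∞} (hk : Measurable k) (hki : RaiseInvariant i a l k) :
    ∫⁻ ω, (Ioc a (τ (X ω))).indicator (fun _ => k (X ω)) (X ω i) ∂P =
      ∫⁻ ω, k (update (X ω) i l) *
        P ((fun ω' => X ω' i) ⁻¹' Ioc a (τ (update (X ω) i l))) ∂P := by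
  have hX := h.measurable
  have hXi : Measurable fun ω => X ω i := by fun_prop
  have hZ : Measurable fun ω => update (X ω) i l := by fun_prop
  let F (q : ℝ × (ι → ℝ)) : ℝ≥0∞ := (Ioc a (τ q.2)).indicator (fun _ => k q.2) q.1
  have hmem : MeasurableSet {q : ℝ × (ι → ℝ) | q.1 ∈ Ioc a (τ q.2)} :=
    (measurableSet_lt measurable_const measurable_fst).inter
      (measurableSet_le measurable_fst (hτ.comp measurable_snd))
  have hF : Measurable F := (hk.comp measurable_snd).indicator hmem
  have hraise (ω) : (Ioc a (τ (X ω))).indicator (fun _ => k (X ω)) (X ω i) =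
      F (X ω i, update (X ω) i l) := by
    by_cases hx : X ω i ∈ Ioc a l
    · simp only [F, hτi _ hx, hki _ hx]
    · have hnot (x : ι → ℝ) : X ω i ∉ Ioc a (τ x) :=
        fun hm => hx (Ioc_subset_Ioc_right (hτl x) hm)
      simp only [F, indicator_of_notMem (hnot _)]
  simp only [hraise]
  rw [lintegral_comp_prodMk_of_indepFun hXi hZ (h.indepFun_update i hi) hF]
  refine lintegral_congr fun ω => ?_
  set z := update (X ω) i l
  exact lintegral_indicator_const (s := (fun ω' => X ω' i) ⁻¹' Ioc a (τ z))
    (hXi measurableSet_Ioc) (k z)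

lemma IndepUniformOnIoc.lintegral_indicator_Ioc_le (h : IndepUniformOnIoc P X I a l) (hi : i ∈ I)
    {τ : (ι → ℝ) → ℝ} (hτ : Measurable τ) (hτi : RaiseInvariant i a l τ) (hτl : ∀ x, τ x ≤ l)
    {k : (ι → ℝ) → ℝ≥0∞} (hk : Measurable k) (hki : RaiseInvariant i a l k) :
    ∫⁻ ω, (Ioc a (τ (X ω))).indicator (fun _ => k (X ω)) (X ω i) ∂P ≤
      ∫⁻ ω, (Ioc a l).indicator
        (fun _ => ENNReal.ofReal ((τ (X ω) - a) / (l - a)) * k (X ω)) (X ω i) ∂P := by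
  rw [h.lintegral_indicator_Ioc_eq hi hτ hτi hτl hk hki,
    h.lintegral_indicator_Ioc_eq hi (τ := fun _ => l)
      (k := fun x => ENNReal.ofReal ((τ x - a) / (l - a)) * k x) measurable_const
      (fun _ _ => rfl) (fun _ => le_rfl) (by fun_prop) fun x hx => by
      simp only [hτi x hx, hki x hx]]
  refine lintegral_mono fun ω => ?_
  set z := update (X ω) i l
  rcases le_or_gt a (τ z) with hz | hz
  · rw [h.measure_preimage_Ioc i hi _ ⟨hz, hτl z⟩, mul_left_comm, mul_assoc]
  · simp [Ioc_eq_empty hz.not_gt]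

/-- Integrating out the `i`-th coordinate alone cancels its weight against its threshold. -/
lemma IndepUniformOnIoc.lintegral_leaveOneOutWeight_le (h : IndepUniformOnIoc P X I a l)
    (hB : AdmissibleBoundary I a l ρ b s E) (hl : 0 ≤ l) (hal : a < l) (M : ℕ) (hi : i ∈ I) :
    ∫⁻ ω, (Ioc a (leaveOneOutThreshold I a l (b (X ω)) (s (X ω)) M i (X ω))).indicator
        (fun _ => E.indicator (fun x => leaveOneOutWeight I a l (b x) (s x) M i x) (X ω))
        (X ω i) ∂P ≤
      ∫⁻ ω, (Ioc a l).indicator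
        (fun _ => E.indicator (fun x => ENNReal.ofReal (b x / (l - a))) (X ω)) (X ω i) ∂P := by
  have hτi : RaiseInvariant i a l fun x => leaveOneOutThreshold I a l (b x) (s x) M i x :=
    fun x hx => by
      simp only [hB.slope_raise i hi x hx, hB.shift_raise i hi x hx, leaveOneOutThreshold_update]
  have hki : RaiseInvariant i a l
      (E.indicator fun x => leaveOneOutWeight I a l (b x) (s x) M i x) := fun x hx => by
    have hE : update x i l ∈ E ↔ x ∈ E := Iff.of_eq (hB.mem_raise i hi x hx)
    by_cases hxE : x ∈ E
    · simp only [indicator_of_mem (hE.2 hxE), indicator_of_mem hxE, hB.slope_raise i hi x hx,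
        hB.shift_raise i hi x hx, leaveOneOutWeight_update]
    · simp only [indicator_of_notMem (mt hE.1 hxE), indicator_of_notMem hxE]
  refine (h.lintegral_indicator_Ioc_le hi
    (measurable_leaveOneOutThreshold hB.measurable_slope hB.measurable_shift) hτi
    (fun _ => leaveOneOutThreshold_le hl)
    ((measurable_leaveOneOutWeight hB.measurable_slope hB.measurable_shift).indicator
      hB.measurableSet) hki).trans (lintegral_mono fun ω => indicator_le_indicator ?_)
  by_cases hE : X ω ∈ E
  · simp only [indicator_of_mem hE]
    exact ofReal_leaveOneOutThreshold_mul_weight_le (hB.slope_nonneg _ hE) hl hal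
      (hB.shift_mul_slope_le _ hE)
  · simp [hE]

lemma AdmissibleBoundary.sum_indicator_slope_le (hB : AdmissibleBoundary I a l ρ b s E)
    (hal : a < l) (x : ι → ℝ) :
    ∑ i ∈ I, (Ioc a l).indicator
      (fun _ => E.indicator (fun x => ENNReal.ofReal (b x / (l - a))) x) (x i) ≤
      E.indicator (fun _ => ENNReal.ofReal ρ) x := by
  by_cases hx : x ∈ E
  · simp only [indicator_of_mem hx, indicator_apply]
    rw [← Finset.sum_filter, Finset.sum_const, nsmul_eq_mul, ← ENNReal.ofReal_natCast,
      ← ENNReal.ofReal_mul (Nat.cast_nonneg _), ← mul_div_assoc]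
    exact ENNReal.ofReal_le_ofReal
      ((div_le_iff₀ (sub_pos.2 hal)).2 (hB.count_mul_slope_le x hx))
  · simp [hx]

theorem IndepUniformOnIoc.measure_crossing_le (h : IndepUniformOnIoc P X I a l)
    (hB : AdmissibleBoundary I a l ρ b s E) (hl : 0 ≤ l) (hal : a < l) (M : ℕ) :
    P {ω | X ω ∈ E ∧ 1 ≤ countIoc I a
        (lastCrossing I a l (b (X ω)) (s (X ω)) M (X ω) * b (X ω)) (X ω)} ≤
      ENNReal.ofReal ρ * P (X ⁻¹' E) := by
  have hX := h.measurable
  have hXi (i : ι) : Measurable fun ω => X ω i := by fun_prop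
  have hb := hB.measurable_slope
  have hs := hB.measurable_shift
  let W (i : ι) (ω : Ω) : ℝ≥0∞ :=
    (Ioc a (leaveOneOutThreshold I a l (b (X ω)) (s (X ω)) M i (X ω))).indicator
      (fun _ => E.indicator (fun x => leaveOneOutWeight I a l (b x) (s x) M i x) (X ω)) (X ω i)
  let S (i : ι) (ω : Ω) : ℝ≥0∞ := (Ioc a l).indicator
    (fun _ => E.indicator (fun x => ENNReal.ofReal (b x / (l - a))) (X ω)) (X ω i)
  have hW (i : ι) : Measurable (W i) := Measurable.indicator
    (((measurable_leaveOneOutWeight hb hs).indicator hB.measurableSet).comp hX)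
    ((measurableSet_lt measurable_const (hXi i)).inter
      (measurableSet_le (hXi i) ((measurable_leaveOneOutThreshold hb hs).comp hX)))
  have hS (i : ι) : Measurable (S i) := Measurable.indicator
    (((hb.div_const _).ennreal_ofReal.indicator hB.measurableSet).comp hX)
    (hXi i measurableSet_Ioc)
  calc _ ≤ ∫⁻ ω, ∑ i ∈ I, W i ω ∂P := by
        refine meas_le_lintegral₀ (Finset.measurable_sum _ fun i _ => hW i).aemeasurable ?_
        rintro ω ⟨hE, hcross⟩
        simp only [W, indicator_of_mem hE]
        exact one_le_sum_leaveOneOutWeight (hB.slope_nonneg _ hE) hl hcross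
    _ = ∑ i ∈ I, ∫⁻ ω, W i ω ∂P := lintegral_finsetSum _ fun i _ => hW i
    _ ≤ ∑ i ∈ I, ∫⁻ ω, S i ω ∂P :=
        Finset.sum_le_sum fun i hi => h.lintegral_leaveOneOutWeight_le hB hl hal M hi
    _ = ∫⁻ ω, ∑ i ∈ I, S i ω ∂P := (lintegral_finsetSum _ fun i _ => hS i).symm
    _ ≤ ∫⁻ ω, (X ⁻¹' E).indicator (fun _ => ENNReal.ofReal ρ) ω ∂P :=
        lintegral_mono fun ω => hB.sum_indicator_slope_le hal (X ω)
    _ = _ := lintegral_indicator_const (hX hB.measurableSet) _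

end LeaveOneOut

section StepUp

variable {m : ℕ} {α lam : ℝ} {g : (Ici lam → ℝ) → ℝ} {I I₀ : Finset (Fin m)} {x : Fin m → ℝ}
  {i : Fin m}

lemma countLE_eq_card (x : Fin m → ℝ) (t : ℝ) :
    countLE x t = (Finset.univ.filter fun i => x i ≤ t).card := by
  rcases Nat.eq_zero_or_pos m with rfl | hm
  · simp [countLE]
  · rw [countLE, empCDF, mul_div_cancel₀ _ (Nat.cast_ne_zero.2 hm.ne')]

lemma filter_le_update {t l : ℝ} (hlt : l ≤ t) (hi : x i ≤ l) (J : Finset (Fin m)) :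
    (J.filter fun j => update x i l j ≤ t) = J.filter fun j => x j ≤ t := by
  refine Finset.filter_congr fun j _ => ?_
  rcases eq_or_ne j i with rfl | hji
  · simp [hlt, hi.trans hlt]
  · rw [update_of_ne hji]

lemma empCDF_update {t l : ℝ} (hlt : l ≤ t) (hi : x i ≤ l) :
    empCDF (update x i l) t = empCDF x t := by
  rw [empCDF, filter_le_update hlt hi, empCDF]

lemma estimate_update (hi : x i ≤ lam) : estimate lam g (update x i lam) = estimate lam g x :=
  congrArg g (funext fun t => empCDF_update t.2 hi)

lemma measurable_card_filter_le (J : Finset (Fin m)) (t : ℝ) :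
    Measurable fun x : Fin m → ℝ => (J.filter fun i => x i ≤ t).card := by
  simp only [Finset.card_filter]
  exact Finset.measurable_sum _ fun i _ => Measurable.ite
    (measurableSet_le (measurable_pi_apply i) measurable_const) measurable_const measurable_const

lemma measurable_empCDF (t : ℝ) : Measurable fun x : Fin m → ℝ => empCDF x t :=
  (measurable_from_nat.comp (measurable_card_filter_le Finset.univ t)).div_const _

lemma measurable_estimate (hg : Measurable g) :
    Measurable fun x : Fin m → ℝ => estimate lam g x :=
  hg.comp (measurable_pi_iff.2 fun t => measurable_empCDF t)

lemma le_card_of_orderStat_le {r : ℕ} (hrm : r ≤ m) {c : ℝ} (h : orderStat x r ≤ c) :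
    r ≤ (Finset.univ.filter fun i => x i ≤ c).card := by
  rcases Nat.eq_zero_or_pos r with rfl | hr
  · exact Nat.zero_le _
  rw [orderStat, dif_pos ⟨hr, hrm⟩] at h
  let f : Fin r → Fin m := fun j => Tuple.sort x (Fin.castLE hrm j)
  have hf : Injective f := (Tuple.sort x).injective.comp (Fin.castLE_injective hrm)
  calc r = (Finset.univ.image f).card := by simp [Finset.card_image_of_injective _ hf]
    _ ≤ _ := Finset.card_le_card fun i hi => by
      obtain ⟨j, -, rfl⟩ := Finset.mem_image.1 hi
      refine Finset.mem_filter.2 ⟨Finset.mem_univ _, le_trans ?_ h⟩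
      exact Tuple.monotone_sort x (Fin.le_def.2 (by simp; omega))

lemma orderStat_numRej_le (hlam : 0 ≤ lam) :
    orderStat x (numRej α lam g x) ≤ critVal α lam g x (numRej α lam g x) :=
  Nat.findGreatest_spec (P := fun i => orderStat x i ≤ critVal α lam g x i) (Nat.zero_le m)
    (by simp [orderStat, critVal, hlam])

lemma numRej_le_card (hlam : 0 ≤ lam) : numRej α lam g x ≤
    (Finset.univ.filter fun i => x i ≤ critVal α lam g x (numRej α lam g x)).card :=
  le_card_of_orderStat_le (Nat.findGreatest_le _) (orderStat_numRej_le hlam)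

lemma numFalseRej_mono (h : I₀ ⊆ I) : numFalseRej α lam g I₀ x ≤ numFalseRej α lam g I x :=
  Finset.card_le_card (Finset.filter_subset_filter _ h)

lemma fdp_eq_zero (h : numFalseRej α lam g I x = 0) : fdp α lam g I x = 0 := by
  simp [fdp, h]

lemma fdr_nonneg {Ω : Type*} [MeasurableSpace Ω] (P : Measure Ω) (p : Fin m → Ω → ℝ) :
    0 ≤ fdr P p α lam g I :=
  integral_nonneg fun _ => div_nonneg (Nat.cast_nonneg _) (Nat.cast_nonneg _)

/-- The configurations for which the estimator `m̂₀` is at least `(C α / lam) (Rₘ(lam) ∨ 1)`. -/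
def conservativeSet (α lam : ℝ) (g : (Ici lam → ℝ) → ℝ) (C : ℝ) : Set (Fin m → ℝ) :=
  {x | C * α / lam * max (countLE x lam) 1 ≤ estimate lam g x}

/-- The conservative configurations in which the hypotheses outside `I` shift the rejection boundary
by at most `a` and no p-value with index in `I` is at most `a`. -/
def controlledSet (α lam : ℝ) (g : (Ici lam → ℝ) → ℝ) (C a : ℝ) (I : Finset (Fin m)) :
    Set (Fin m → ℝ) :=
  {x | x ∈ conservativeSet α lam g C ∧
    (Iᶜ.filter fun i => x i ≤ lam).card * (α / estimate lam g x) ≤ a ∧ ∀ i ∈ I, a < x i}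

variable {C a ρ : ℝ}

lemma measurableSet_conservativeSet (hg : Measurable g) :
    MeasurableSet (conservativeSet α lam g C : Set (Fin m → ℝ)) :=
  measurableSet_le ((((measurable_empCDF lam).const_mul _).max measurable_const).const_mul _)
    (measurable_estimate hg)

lemma measurableSet_controlledSet (hg : Measurable g) :
    MeasurableSet (controlledSet α lam g C a I) := by
  have hshift : Measurable fun x : Fin m → ℝ => ((Iᶜ.filter fun i => x i ≤ lam).card : ℝ) :=
    measurable_from_nat.comp (measurable_card_filter_le _ _)
  have hlt : MeasurableSet {x : Fin m → ℝ | ∀ i ∈ I, a < x i} := by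
    simp only [ofPred_forall]
    exact Finset.measurableSet_biInter I fun i _ =>
      measurableSet_lt measurable_const (measurable_pi_apply i)
  exact (measurableSet_conservativeSet hg).inter
    ((measurableSet_le (hshift.mul ((measurable_estimate hg).const_div α)) measurable_const).inter
      hlt)

lemma estimate_pos_of_mem_conservativeSet (hα : 0 < α) (hlam : 0 < lam) (hC : 0 < C)
    (hx : x ∈ conservativeSet α lam g C) : 0 < estimate lam g x :=
  lt_of_lt_of_le (by positivity) hx

lemma card_mul_slope_le_of_mem_conservativeSet (hα : 0 < α) (hlam : 0 < lam) (hC : 0 < C)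
    (hx : x ∈ conservativeSet α lam g C) :
    (Finset.univ.filter fun i => x i ≤ lam).card * (α / estimate lam g x) ≤ lam / C := by
  have hpos := estimate_pos_of_mem_conservativeSet hα hlam hC hx
  rw [← countLE_eq_card, mul_div_assoc', div_le_div_iff₀ hpos hC]
  have hle : C * α / lam * countLE x lam ≤ estimate lam g x :=
    (mul_le_mul_of_nonneg_left (le_max_left _ _) (by positivity)).trans hx
  rw [div_mul_eq_mul_div, div_le_iff₀ hlam] at hle
  linarith

lemma raiseInvariant_mem_controlledSet (hal : a < lam) :
    RaiseInvariant i a lam (· ∈ controlledSet α lam g C a I) := fun x hx => by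
  have hforall : (∀ j ∈ I, a < update x i lam j) ↔ ∀ j ∈ I, a < x j := by
    refine forall₂_congr fun j _ => ?_
    rcases eq_or_ne j i with rfl | hji
    · simp [hal, hx.1]
    · rw [update_of_ne hji]
  simp only [controlledSet, conservativeSet, mem_ofPred_eq, estimate_update hx.2, countLE,
    filter_le_update le_rfl hx.2, empCDF_update le_rfl hx.2, hforall]

lemma admissibleBoundary_controlledSet (hg : Measurable g) (hα : 0 < α) (hlam : 0 < lam)
    (hC : 0 < C) (hal : a < lam) (hρ : lam / C ≤ ρ * (lam - a)) :
    AdmissibleBoundary I a lam ρ (fun x => α / estimate lam g x)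
      (fun x => (Iᶜ.filter fun i => x i ≤ lam).card) (controlledSet α lam g C a I) where
  measurable_slope := (measurable_estimate hg).const_div α
  measurable_shift := measurable_card_filter_le _ _
  measurableSet := measurableSet_controlledSet hg
  slope_raise i _ x hx := congrArg (α / ·) (estimate_update hx.2)
  shift_raise i _ x hx := congrArg Finset.card (filter_le_update le_rfl hx.2 _)
  mem_raise i _ := raiseInvariant_mem_controlledSet hal
  slope_nonneg x hx :=
    div_nonneg hα.le (estimate_pos_of_mem_conservativeSet hα hlam hC hx.1).le
  shift_mul_slope_le x hx := hx.2.1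
  count_mul_slope_le x hx := by
    have hpos := estimate_pos_of_mem_conservativeSet hα hlam hC hx.1
    refine le_trans ?_ ((card_mul_slope_le_of_mem_conservativeSet hα hlam hC hx.1).trans hρ)
    gcongr
    exact Finset.card_le_card fun i hi =>
      Finset.mem_filter.2 ⟨Finset.mem_univ i, (Finset.mem_filter.1 hi).2.2⟩

lemma critVal_numRej_eq (hα : 0 < α) (hlam : 0 < lam) (hC : 1 ≤ C)
    (hx : x ∈ conservativeSet α lam g C) :
    critVal α lam g x (numRej α lam g x) = numRej α lam g x * (α / estimate lam g x) := by
  have hC₀ : 0 < C := by positivity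
  have hpos := estimate_pos_of_mem_conservativeSet hα hlam hC₀ hx
  rw [critVal, div_mul_eq_mul_div, mul_div_assoc]
  refine min_eq_left ?_
  calc numRej α lam g x * (α / estimate lam g x)
      ≤ (Finset.univ.filter fun i => x i ≤ lam).card * (α / estimate lam g x) := by
        gcongr
        exact (numRej_le_card hlam.le).trans (Finset.card_le_card
          (Finset.monotone_filter_right _ fun _ _ hi => hi.trans (min_le_right _ _)))
    _ ≤ lam / C := card_mul_slope_le_of_mem_conservativeSet hα hlam hC₀ hx
    _ ≤ lam := div_le_self hlam.le hC

lemma numRej_le_card_add_numFalseRej (hlam : 0 ≤ lam) (I : Finset (Fin m)) :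
    numRej α lam g x ≤ (Iᶜ.filter fun i => x i ≤ lam).card + numFalseRej α lam g I x := by
  set c := critVal α lam g x (numRej α lam g x)
  calc numRej α lam g x ≤ (Finset.univ.filter fun i => x i ≤ c).card := numRej_le_card hlam
    _ = (Iᶜ.filter fun i => x i ≤ c).card + (I.filter fun i => x i ≤ c).card := by
        rw [← Finset.card_union_of_disjoint (Finset.disjoint_filter_filter disjoint_compl_left),
          ← Finset.filter_union, Finset.union_comm, Finset.union_compl]
    _ ≤ _ := Nat.add_le_add_right (Finset.card_le_card
        (Finset.monotone_filter_right _ fun _ _ hi => hi.trans (min_le_right _ _))) _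

lemma one_le_countIoc_lastCrossing (hα : 0 < α) (hlam : 0 < lam) (hC : 1 ≤ C)
    (hx : x ∈ controlledSet α lam g C a I) (hV : numFalseRej α lam g I x ≠ 0) :
    1 ≤ countIoc I a (lastCrossing I a lam (α / estimate lam g x)
      (Iᶜ.filter fun i => x i ≤ lam).card m x * (α / estimate lam g x)) x := by
  have hpos := estimate_pos_of_mem_conservativeSet hα hlam (by positivity) hx.1
  have hcrit := critVal_numRej_eq hα hlam hC hx.1
  have hcount : numFalseRej α lam g I x =
      countIoc I a (numRej α lam g x * (α / estimate lam g x)) x := by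
    rw [numFalseRej, hcrit, countIoc]
    exact congrArg _ (Finset.filter_congr fun i hi => by simp [hx.2.2 i hi])
  have hle : numRej α lam g x ≤ lastCrossing I a lam (α / estimate lam g x)
      (Iᶜ.filter fun i => x i ≤ lam).card m x :=
    le_lastCrossing (Nat.findGreatest_le m) (hcrit.symm.le.trans (min_le_right _ _))
      (hcount ▸ numRej_le_card_add_numFalseRej hlam.le I)
  calc 1 ≤ numFalseRej α lam g I x := Nat.one_le_iff_ne_zero.2 hV
    _ = countIoc I a (numRej α lam g x * (α / estimate lam g x)) x := hcount
    _ ≤ _ := countIoc_mono (by gcongr)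

theorem IndepUniformOnIoc.le_measureReal_numFalseRej_eq_zero {Ω : Type*} [MeasurableSpace Ω]
    {P : Measure Ω} [IsProbabilityMeasure P] {X : Ω → Fin m → ℝ}
    (h : IndepUniformOnIoc P X I a lam) (hI : I₀ ⊆ I) (hg : Measurable g) (hα : 0 < α)
    (hlam : 0 < lam) (hC : 1 ≤ C) (hal : a < lam) :
    (1 - lam / (C * (lam - a))) * P.real (X ⁻¹' controlledSet α lam g C a I) ≤
      P.real {ω | numFalseRej α lam g I₀ (X ω) = 0} := by
  have hla : 0 < lam - a := sub_pos.2 hal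
  set ρ := lam / (C * (lam - a))
  have hρ : lam / C = ρ * (lam - a) := by simp only [ρ]; field_simp
  have hcross := ENNReal.toReal_mono (by finiteness) (h.measure_crossing_le
    (admissibleBoundary_controlledSet hg hα hlam (by positivity) hal hρ.le) hlam.le hal m)
  rw [ENNReal.toReal_mul, ENNReal.toReal_ofReal (by positivity)] at hcross
  set B := {ω | X ω ∈ controlledSet α lam g C a I ∧ 1 ≤ countIoc I a _ (X ω)}
  have hsub : X ⁻¹' controlledSet α lam g C a I ⊆ {ω | numFalseRej α lam g I₀ (X ω) = 0} ∪ B :=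
    fun ω hω => or_iff_not_imp_left.2 fun hV => ⟨hω, one_le_countIoc_lastCrossing hα hlam hC hω
      fun h₀ => hV (Nat.le_zero.1 ((numFalseRej_mono hI).trans h₀.le))⟩
  have hunion := (measureReal_mono hsub).trans (measureReal_union_le (μ := P) _ _)
  simp only [← measureReal_def] at hcross
  linarith

end StepUp

section Independence

variable {Ω : Type*} [MeasurableSpace Ω] {P : Measure Ω} [IsProbabilityMeasure P]

lemma indepFun_prodMk_right_of_prodMk_left {β γ δ : Type*} [MeasurableSpace β]
    [MeasurableSpace γ] [MeasurableSpace δ] {A : Ω → β} {B : Ω → γ} {Y : Ω → δ}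
    (hA : Measurable A) (hB : Measurable B) (hY : Measurable Y) (hAB : IndepFun A B P)
    (h : IndepFun (fun ω => (A ω, B ω)) Y P) : IndepFun A (fun ω => (B ω, Y ω)) P := by
  have hBY : IndepFun B Y P := h.comp measurable_snd measurable_id
  have : IsProbabilityMeasure (P.map A) := Measure.isProbabilityMeasure_map hA.aemeasurable
  have : IsProbabilityMeasure (P.map B) := Measure.isProbabilityMeasure_map hB.aemeasurable
  have : IsProbabilityMeasure (P.map Y) := Measure.isProbabilityMeasure_map hY.aemeasurable
  rw [indepFun_iff_map_prod_eq_prod_map_map hA.aemeasurable (hB.prodMk hY).aemeasurable]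
  rw [indepFun_iff_map_prod_eq_prod_map_map (hA.prodMk hB).aemeasurable hY.aemeasurable] at h
  rw [indepFun_iff_map_prod_eq_prod_map_map hA.aemeasurable hB.aemeasurable] at hAB
  rw [indepFun_iff_map_prod_eq_prod_map_map hB.aemeasurable hY.aemeasurable] at hBY
  rw [hBY, ← Measure.prodAssoc_prod, ← hAB, ← h,
    Measure.map_map MeasurableEquiv.prodAssoc.measurable ((hA.prodMk hB).prodMk hY)]
  rfl

variable {ι : Type*} {p : ι → Ω → ℝ} {J K : Finset ι} {i : ι}

lemma indepFun_prodMk_blocks [DecidableEq ι] (hp : ∀ i, Measurable (p i))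
    (hJK : IndepFun (fun ω (j : J) => p j ω) (fun ω (j : K) => p j ω) P)
    (hJ : iIndepFun (fun j : J => p j) P) (hi : i ∈ J) :
    IndepFun (p i)
      (fun ω => (fun j : J.erase i => p j ω, fun j : K => p j ω)) P := by
  have hrest : IndepFun (p i) (fun ω (j : J.erase i) => p j ω) P := by
    let T : Finset J := Finset.univ.erase ⟨i, hi⟩
    let φ (v : T → ℝ) (j : J.erase i) : ℝ := v ⟨⟨j, Finset.mem_of_mem_erase j.2⟩, by
      simpa [T, Subtype.ext_iff] using Finset.ne_of_mem_erase j.2⟩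
    exact (hJ.indepFun_finset {⟨i, hi⟩} T (by simp [T]) fun j => hp j).comp
      (measurable_pi_apply ⟨_, Finset.mem_singleton_self _⟩)
      (show Measurable φ from measurable_pi_lambda _ fun _ => measurable_pi_apply _)
  refine indepFun_prodMk_right_of_prodMk_left (hp i) (measurable_pi_lambda _ fun j => hp j)
    (measurable_pi_lambda _ fun j => hp j) hrest ?_
  let φ (v : J → ℝ) : ℝ × (J.erase i → ℝ) :=
    (v ⟨i, hi⟩, fun j => v ⟨j, Finset.mem_of_mem_erase j.2⟩)
  have hφ : Measurable φ := (measurable_pi_apply _).prodMk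
    (measurable_pi_lambda _ fun _ => measurable_pi_apply _)
  exact hJK.comp hφ measurable_id

lemma indepFun_update [DecidableEq ι] (hp : ∀ i, Measurable (p i)) (hcover : ∀ i, i ∈ J ∨ i ∈ K)
    (hJK : IndepFun (fun ω (j : J) => p j ω) (fun ω (j : K) => p j ω) P)
    (hJ : iIndepFun (fun j : J => p j) P) (hi : i ∈ J) (c : ℝ) :
    IndepFun (p i) (fun ω => update (fun j => p j ω) i c) P := by
  let φ (q : (J.erase i → ℝ) × (K → ℝ)) (j : ι) : ℝ :=
    if hji : j = i then c else if hjJ : j ∈ J then q.1 ⟨j, Finset.mem_erase.2 ⟨hji, hjJ⟩⟩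
    else q.2 ⟨j, (hcover j).resolve_left hjJ⟩
  have hφ : Measurable φ := measurable_pi_lambda _ fun j => by
    simp only [φ]
    split_ifs <;> fun_prop
  have hupdate : (fun ω => update (fun j => p j ω) i c) =
      φ ∘ fun ω => (fun j : J.erase i => p j ω, fun j : K => p j ω) := by
    ext ω j
    simp only [φ, comp_apply, update_apply]
    split_ifs <;> rfl
  rw [hupdate]
  exact (indepFun_prodMk_blocks hp hJK hJ hi).comp measurable_id hφ

lemma measureReal_card_filter_lt_le {E : Type*} [MeasurableSpace E] {X : ι → Ω → E} {I : Finset ι}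
    {S : Set E} [DecidablePred (· ∈ S)] {q : ℝ} (hX : ∀ i ∈ I, Measurable (X i))
    (hS : MeasurableSet S) (hind : (I : Set ι).Pairwise fun i j => IndepFun (X i) (X j) P)
    (hq : 0 < q) (hprob : ∀ i ∈ I, P.real (X i ⁻¹' S) = q) (hI : I.Nonempty) :
    P.real {ω | ((I.filter fun i => X i ω ∈ S).card : ℝ) < q / 2 * I.card} ≤
      1 / (q ^ 2 * I.card) := by
  have : (0 : ℝ) < I.card := Nat.cast_pos.2 hI.card_pos
  let Y (i : ι) : Ω → ℝ := S.indicator 1 ∘ X i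
  have hone : Measurable (S.indicator (1 : E → ℝ)) := measurable_one.indicator hS
  have hY (i) (hi : i ∈ I) : Measurable (Y i) := hone.comp (hX i hi)
  have hbound (i ω) : Y i ω ∈ Icc (0 : ℝ) 1 :=
    ⟨indicator_nonneg (fun _ _ => zero_le_one) _, indicator_le_self' (fun _ _ => zero_le_one) _⟩
  have hmem (i) (hi : i ∈ I) : MemLp (Y i) 2 P :=
    MemLp.of_bound (hY i hi).aestronglyMeasurable 1 (.of_forall fun ω => by
      rw [Real.norm_of_nonneg (hbound i ω).1]; exact (hbound i ω).2)
  have hmean : ∫ ω, (∑ i ∈ I, Y i) ω ∂P = q * I.card := by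
    simp only [Finset.sum_apply]
    have hterm (i) (hi : i ∈ I) : ∫ ω, Y i ω ∂P = q :=
      (integral_indicator_one (hX i hi hS)).trans (hprob i hi)
    rw [integral_finsetSum _ fun i hi => (hmem i hi).integrable one_le_two,
      Finset.sum_congr rfl hterm, Finset.sum_const, nsmul_eq_mul, mul_comm]
  have hvar : Var[∑ i ∈ I, Y i; P] ≤ I.card / 4 := by
    rw [IndepFun.variance_sum hmem fun i hi j hj hij => (hind hi hj hij).comp hone hone]
    refine (Finset.sum_le_card_nsmul I _ (1 / 4) fun i hi => ?_).trans_eq (by simp [div_eq_mul_inv])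
    exact (variance_le_sq_of_bounded (.of_forall (hbound i)) (hY i hi).aemeasurable).trans_eq
      (by norm_num)
  have hcard (ω) : (∑ i ∈ I, Y i) ω = ((I.filter fun i => X i ω ∈ S).card : ℝ) := by
    simp [Y, indicator_apply]
  have hsub : {ω | ((I.filter fun i => X i ω ∈ S).card : ℝ) < q / 2 * I.card} ⊆
      {ω | q / 2 * I.card ≤ |(∑ i ∈ I, Y i) ω - ∫ ω, (∑ i ∈ I, Y i) ω ∂P|} := fun ω hω => by
    rw [mem_ofPred_eq, hmean, hcard, abs_sub_comm]
    exact le_trans (by linarith [hω.out]) (le_abs_self _)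
  have hcheb := meas_ge_le_variance_div_sq (memLp_finsetSum' I hmem)
    (show 0 < q / 2 * I.card by positivity)
  calc _ ≤ Var[∑ i ∈ I, Y i; P] / (q / 2 * I.card) ^ 2 :=
        ENNReal.toReal_le_of_le_ofReal (div_nonneg (variance_nonneg _ _) (sq_nonneg _))
          ((measure_mono hsub).trans hcheb)
    _ ≤ I.card / 4 / (q / 2 * I.card) ^ 2 := by gcongr
    _ = 1 / (q ^ 2 * I.card) := by field_simp; norm_num

end Independence

section Uniform

variable {Ω : Type*} [MeasurableSpace Ω] {P : Measure Ω} {X : Ω → ℝ} {a u : ℝ}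

lemma measure_preimage_Ioc_of_isUniform (hu : 0 < u) (hX : pdf.IsUniform X (Icc 0 u) P volume)
    {t : ℝ} (ha : 0 ≤ a) (ht : t ≤ u) : P (X ⁻¹' Ioc a t) = ENNReal.ofReal ((t - a) / u) := by
  rw [hX.measure_preimage (by simp [hu]) (by simp) measurableSet_Ioc,
    inter_eq_right.2 (Ioc_subset_Icc_self.trans (Icc_subset_Icc ha ht)), Real.volume_Ioc,
    Real.volume_Icc, sub_zero, ENNReal.ofReal_div_of_pos hu]

lemma measure_preimage_Ioc_mul_of_isUniform (hu : 0 < u)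
    (hX : pdf.IsUniform X (Icc 0 u) P volume) {l t : ℝ} (ha : 0 ≤ a) (hal : a < l) (hl : l ≤ u)
    (ht : t ∈ Icc a l) :
    P (X ⁻¹' Ioc a t) = ENNReal.ofReal ((t - a) / (l - a)) * P (X ⁻¹' Ioc a l) := by
  have hla : 0 < l - a := sub_pos.2 hal
  rw [measure_preimage_Ioc_of_isUniform hu hX ha (ht.2.trans hl),
    measure_preimage_Ioc_of_isUniform hu hX ha hl,
    ← ENNReal.ofReal_mul (div_nonneg (sub_nonneg.2 ht.1) hla.le), div_mul_div_cancel₀ hla.ne']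

lemma measure_preimage_Iic_of_isUniform (hu : 0 < u) (hX : pdf.IsUniform X (Icc 0 u) P volume)
    {t : ℝ} (ht : t ≤ u) : P (X ⁻¹' Iic t) = ENNReal.ofReal (t / u) := by
  have hinter : Icc 0 u ∩ Iic t = Icc 0 t :=
    Set.ext fun x => ⟨fun h => ⟨h.1.1, h.2⟩, fun h => ⟨⟨h.1, h.2.trans ht⟩, h.2⟩⟩
  rw [hX.measure_preimage (by simp [hu]) (by simp) measurableSet_Iic, hinter, Real.volume_Icc,
    Real.volume_Icc, sub_zero, sub_zero, ENNReal.ofReal_div_of_pos hu]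

lemma ae_pos_of_isUniform (hu : 0 < u) (hX : pdf.IsUniform X (Icc 0 u) P volume) :
    ∀ᵐ ω ∂P, 0 < X ω := by
  have hnull : P (X ⁻¹' Iic 0) = 0 := by
    rw [measure_preimage_Iic_of_isUniform hu hX hu.le, zero_div, ENNReal.ofReal_zero]
  filter_upwards [measure_eq_zero_iff_ae_notMem.1 hnull] with ω hω
  exact not_le.1 hω

lemma measure_preimage_Ioi_of_isUniform (hX : pdf.IsUniform X (Icc 0 1) P volume) (ha : 0 ≤ a) :
    P (X ⁻¹' Ioi a) = ENNReal.ofReal (1 - a) := by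
  have hinter : Icc 0 1 ∩ Ioi a = Ioc a 1 :=
    Set.ext fun x => ⟨fun h => ⟨h.2, h.1.2⟩, fun h => ⟨⟨ha.trans h.1.le, h.2⟩, h.1⟩⟩
  rw [hX.measure_preimage (by simp) (by simp) measurableSet_Ioi]
  simp [hinter]

variable {ι : Type*} {p : ι → Ω → ℝ} {I : Finset ι}

lemma measureReal_forall_lt_of_isUniform (hind : iIndepFun (fun i : I => p i) P)
    (hu : ∀ i ∈ I, pdf.IsUniform (p i) (Icc 0 1) P volume) (ha₀ : 0 ≤ a) (ha₁ : a ≤ 1) :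
    P.real {ω | ∀ i ∈ I, a < p i ω} = (1 - a) ^ I.card := by
  have hInter : {ω | ∀ i ∈ I, a < p i ω} =
      ⋂ i ∈ (Finset.univ : Finset I), p i ⁻¹' Ioi a := by ext; simp
  have hprod : P {ω | ∀ i ∈ I, a < p i ω} = ENNReal.ofReal (1 - a) ^ I.card := by
    rw [hInter, hind.measure_inter_preimage_eq_mul Finset.univ fun _ _ => measurableSet_Ioi,
      Finset.prod_congr rfl fun (i : I) _ =>
        measure_preimage_Ioi_of_isUniform (hu i i.2) ha₀,
      Finset.prod_const, Finset.card_univ, Fintype.card_coe]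
  rw [measureReal_def, hprod, ENNReal.toReal_pow, ENNReal.toReal_ofReal (sub_nonneg.2 ha₁)]

lemma measureReal_card_le_lt_of_isUniform [IsProbabilityMeasure P] (hp : ∀ i ∈ I, Measurable (p i))
    (hind : iIndepFun (fun i : I => p i) P)
    (hu : ∀ i ∈ I, pdf.IsUniform (p i) (Icc 0 1) P volume) (hI : I.Nonempty) {l : ℝ} (hl₀ : 0 < l)
    (hl₁ : l ≤ 1) :
    P.real {ω | ((I.filter fun i => p i ω ≤ l).card : ℝ) < l / 2 * I.card} ≤
      1 / (l ^ 2 * I.card) := by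
  refine measureReal_card_filter_lt_le (S := Iic l) hp measurableSet_Iic
    (fun i hi j hj hij => hind.indepFun (i := ⟨i, hi⟩) (j := ⟨j, hj⟩)
      fun h => hij (congrArg Subtype.val h)) hl₀ (fun i hi => ?_) hI
  rw [measureReal_def, measure_preimage_Iic_of_isUniform one_pos (hu i hi) hl₁, div_one,
    ENNReal.toReal_ofReal hl₀.le]

end Uniform

section FiniteSample

variable {Ω : Type*} [MeasurableSpace Ω] {P : Measure Ω} [IsProbabilityMeasure P] {m : ℕ}
  {p : Fin m → Ω → ℝ} {I₀ : Finset (Fin m)} {α lam C a : ℝ} {g : (Ici lam → ℝ) → ℝ}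

lemma BasicIndependence.indepUniformOnIoc (h : BasicIndependence P p I₀) (ha : 0 ≤ a)
    (hal : a < lam) (hlam : lam ≤ 1) :
    IndepUniformOnIoc P (fun ω i => p i ω) I₀ a lam where
  measurable := measurable_pi_lambda _ h.measurable
  indepFun_update _ hi := indepFun_update h.measurable (fun _ => by simp [em])
    h.indep_true_false h.indep_true hi lam
  measure_preimage_Ioc i hi _ ht :=
    measure_preimage_Ioc_mul_of_isUniform one_pos (h.uniform_true i hi) ha hal hlam ht

lemma BasicIndependence.indepUniformOnIoc_univ (h : BasicIndependence P p I₀) (hlam₀ : 0 < lam)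
    (hlam₁ : lam ≤ 1) (hind : iIndepFun (fun i : {i // i ∈ I₀ᶜ} => p i) P)
    (hu : ∀ i ∈ I₀ᶜ, pdf.IsUniform (p i) (Icc 0 lam) P volume) :
    IndepUniformOnIoc P (fun ω i => p i ω) Finset.univ 0 lam where
  measurable := measurable_pi_lambda _ h.measurable
  indepFun_update i _ := by
    by_cases hi : i ∈ I₀
    · exact (h.indepUniformOnIoc le_rfl hlam₀ hlam₁).indepFun_update i hi
    · exact indepFun_update h.measurable (fun _ => by simp [em']) h.indep_true_false.symm hind
        (Finset.mem_compl.2 hi) lam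
  measure_preimage_Ioc i _ t ht := by
    by_cases hi : i ∈ I₀
    · exact (h.indepUniformOnIoc le_rfl hlam₀ hlam₁).measure_preimage_Ioc i hi t ht
    · exact measure_preimage_Ioc_mul_of_isUniform hlam₀ (hu i (Finset.mem_compl.2 hi)) le_rfl
        hlam₀ le_rfl ht

lemma card_compl_mul_slope_le_of_mem_conservativeSet {x : Fin m → ℝ} {I : Finset (Fin m)} {k : ℕ}
    (hα : 0 < α) (hlam : 0 < lam) (hC : 1 ≤ C) (hx : x ∈ conservativeSet α lam g C)
    (hI : I.Nonempty) (hk : Iᶜ.card ≤ k)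
    (hmany : lam / 2 * I.card ≤ (I.filter fun i => x i ≤ lam).card) :
    (Iᶜ.filter fun i => x i ≤ lam).card * (α / estimate lam g x) ≤ 2 * k / I.card := by
  have hC₀ : 0 < C := by positivity
  have hn : (0 : ℝ) < I.card := Nat.cast_pos.2 hI.card_pos
  have hpos := estimate_pos_of_mem_conservativeSet hα hlam hC₀ hx
  set b := α / estimate lam g x
  have : 0 < b := by positivity
  have hslope : lam * (I.card * b) ≤ lam * 2 :=
    calc lam * (I.card * b) = lam / 2 * I.card * b * 2 := by ring
      _ ≤ (Finset.univ.filter fun i => x i ≤ lam).card * b * 2 := by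
          gcongr
          exact hmany.trans (by gcongr; exact Finset.subset_univ I)
      _ ≤ lam / C * 2 := by
          gcongr
          exact card_mul_slope_le_of_mem_conservativeSet hα hlam hC₀ hx
      _ ≤ lam * 2 := by gcongr; exact div_le_self hlam.le hC
  have hcard : ((Iᶜ.filter fun i => x i ≤ lam).card : ℝ) ≤ k := by
    exact_mod_cast (Finset.card_filter_le _ _).trans hk
  rw [le_div_iff₀ hn]
  calc (Iᶜ.filter fun i => x i ≤ lam).card * b * I.card ≤ k * b * I.card := by gcongr
    _ = I.card * b * k := by ring
    _ ≤ 2 * k := by gcongr; exact le_of_mul_le_mul_left hslope hlam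

lemma BasicIndependence.le_measureReal_controlledSet (h : BasicIndependence P p I₀)
    (hI₀ : I₀.Nonempty) (hg : Measurable g) (hα : 0 < α) (hlam₀ : 0 < lam) (hlam₁ : lam ≤ 1)
    (hC : 1 ≤ C) {k : ℕ} (hk : I₀ᶜ.card ≤ k) (ha : 2 * k / I₀.card ≤ (1 : ℝ)) :
    (1 - 2 * k / I₀.card : ℝ) ^ I₀.card - 1 / (lam ^ 2 * I₀.card) -
        (1 - P.real {ω | (fun i => p i ω) ∈ conservativeSet α lam g C}) ≤
      P.real {ω | (fun i => p i ω) ∈ controlledSet α lam g C (2 * k / I₀.card) I₀} := by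
  set a : ℝ := 2 * k / I₀.card
  let A := {ω | ∀ i ∈ I₀, a < p i ω}
  let G := {ω | (fun i => p i ω) ∈ conservativeSet α lam g C}
  let few := {ω | ((I₀.filter fun i => p i ω ≤ lam).card : ℝ) < lam / 2 * I₀.card}
  have hA : P.real A = (1 - a) ^ I₀.card :=
    measureReal_forall_lt_of_isUniform h.indep_true h.uniform_true (by positivity) ha
  have hfew : P.real few ≤ 1 / (lam ^ 2 * I₀.card) :=
    measureReal_card_le_lt_of_isUniform (fun i _ => h.measurable i) h.indep_true h.uniform_true hI₀
      hlam₀ hlam₁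
  have hG : MeasurableSet G :=
    measurable_pi_lambda _ h.measurable (measurableSet_conservativeSet hg)
  have hsub : A ∩ G ⊆ {ω | (fun i => p i ω) ∈ controlledSet α lam g C a I₀} ∪ few := by
    rintro ω ⟨hωA, hωG⟩
    refine or_iff_not_imp_right.2 fun hω => ⟨hωG, ?_, hωA⟩
    exact card_compl_mul_slope_le_of_mem_conservativeSet hα hlam₀ hC hωG hI₀ hk (not_lt.1 hω)
  have hinter := (measureReal_mono (μ := P) hsub).trans (measureReal_union_le _ _)
  have hunion := measureReal_union_add_inter (μ := P) (s := A) hG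
  have hone : P.real (A ∪ G) ≤ 1 := measureReal_le_one
  linarith

lemma BasicIndependence.le_measureReal_numFalseRej_eq_zero (h : BasicIndependence P p I₀)
    (hI₀ : I₀.Nonempty) (hg : Measurable g) (hα : 0 < α) (hlam₀ : 0 < lam) (hlam₁ : lam ≤ 1)
    (hC : 1 ≤ C) {k : ℕ} (hk : I₀ᶜ.card ≤ k) (hlamC : lam ≤ C * (lam - 2 * k / I₀.card)) :
    (1 - lam / (C * (lam - 2 * k / I₀.card))) *
        ((1 - 2 * k / I₀.card : ℝ) ^ I₀.card - 1 / (lam ^ 2 * I₀.card) -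
          (1 - P.real {ω | (fun i => p i ω) ∈ conservativeSet α lam g C})) ≤
      P.real {ω | numFalseRej α lam g I₀ (fun i => p i ω) = 0} := by
  have hla : 0 < lam - 2 * k / I₀.card :=
    pos_of_mul_pos_right (hlam₀.trans_le hlamC) (by positivity)
  have hal : 2 * k / I₀.card < lam := sub_pos.1 hla
  calc _ ≤ (1 - lam / (C * (lam - 2 * k / I₀.card))) *
        P.real {ω | (fun i => p i ω) ∈ controlledSet α lam g C (2 * k / I₀.card) I₀} := by
        gcongr
        · exact sub_nonneg.2 ((div_le_one (by positivity)).2 hlamC)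
        · exact h.le_measureReal_controlledSet hI₀ hg hα hlam₀ hlam₁ hC hk (hal.le.trans hlam₁)
    _ ≤ _ := (h.indepUniformOnIoc (by positivity) hal hlam₁).le_measureReal_numFalseRej_eq_zero
        subset_rfl hg hα hlam₀ hC hal

lemma BasicIndependence.le_measureReal_numFalseRej_eq_zero_of_uniform
    (h : BasicIndependence P p I₀) (hg : Measurable g) (hα : 0 < α) (hlam₀ : 0 < lam)
    (hlam₁ : lam ≤ 1) (hC : 1 ≤ C) (hind : iIndepFun (fun i : {i // i ∈ I₀ᶜ} => p i) P)
    (hu : ∀ i ∈ I₀ᶜ, pdf.IsUniform (p i) (Icc 0 lam) P volume) :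
    (1 - 1 / C) * P.real {ω | (fun i => p i ω) ∈ conservativeSet α lam g C} ≤
      P.real {ω | numFalseRej α lam g I₀ (fun i => p i ω) = 0} := by
  have hpos : ∀ᵐ ω ∂P, ∀ i, 0 < p i ω := ae_all_iff.2 fun i => by
    by_cases hi : i ∈ I₀
    · exact ae_pos_of_isUniform one_pos (h.uniform_true i hi)
    · exact ae_pos_of_isUniform hlam₀ (hu i (Finset.mem_compl.2 hi))
  have hcontrolled : P.real {ω | (fun i => p i ω) ∈ conservativeSet α lam g C} ≤
      P.real {ω | (fun i => p i ω) ∈ controlledSet α lam g C 0 Finset.univ} := by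
    refine ENNReal.toReal_mono (by finiteness) (measure_mono_ae ?_)
    filter_upwards [hpos] with ω hω hG
    exact ⟨hG, by simp, fun i _ => hω i⟩
  have hmain := (h.indepUniformOnIoc_univ hlam₀ hlam₁ hind hu).le_measureReal_numFalseRej_eq_zero
    (Finset.subset_univ I₀) hg hα hlam₀ hC hlam₀
  rw [sub_zero, mul_comm C, ← div_div, div_self hlam₀.ne'] at hmain
  exact (mul_le_mul_of_nonneg_left hcontrolled
    (sub_nonneg.2 ((div_le_one (by positivity)).2 hC))).trans hmain

end FiniteSample

section Asymptotics

variable {Ω : ℕ → Type*} [∀ m, MeasurableSpace (Ω m)] {P : ∀ m, Measure (Ω m)}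
  [∀ m, IsProbabilityMeasure (P m)] {p : ∀ m, Fin m → Ω m → ℝ} {α lam C : ℝ}
  {g : ℕ → (Ici lam → ℝ) → ℝ} {I₀ : ∀ m, Finset (Fin m)}

lemma Consistent.tendsto_measureReal_numFalseRej_eq_zero (h : Consistent P p α lam g I₀)
    (hFDR : 0 < liminf (fun m => fdr (P m) (p m) α lam (g m) (I₀ m)) atTop) :
    Tendsto (fun m => (P m).real {ω | numFalseRej α lam (g m) (I₀ m) (fun i => p m i ω) = 0})
      atTop (𝓝 0) := by
  obtain ⟨δ, hδ₀, hδ⟩ := exists_between hFDR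
  have hfdr : ∀ᶠ m in atTop, δ < fdr (P m) (p m) α lam (g m) (I₀ m) :=
    eventually_lt_of_lt_liminf hδ (isBoundedUnder_of ⟨0, fun m => fdr_nonneg (P m) (p m)⟩)
  have hdev := (ENNReal.tendsto_toReal ENNReal.zero_ne_top).comp (h δ hδ₀)
  refine squeeze_zero' (.of_forall fun _ => measureReal_nonneg) ?_ hdev
  filter_upwards [hfdr] with m hm
  refine ENNReal.toReal_mono (by finiteness) (measure_mono fun ω hω => ?_)
  rw [mem_ofPred_eq, fdp_eq_zero hω, zero_sub, abs_neg]
  exact hm.le.trans (le_abs_self _)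

lemma tendsto_mul_sub_div (C lam c : ℝ) :
    Tendsto (fun n : ℕ => C * (lam - c / n)) atTop (𝓝 (C * lam)) := by
  simpa only [sub_zero] using
    ((tendsto_const_div_atTop_nhds_zero_nat c).const_sub lam).const_mul C

lemma tendsto_one_sub_div_mul_sub_div (hlam : 0 < lam) (hC : C ≠ 0) (c : ℝ) :
    Tendsto (fun n : ℕ => 1 - lam / (C * (lam - c / n))) atTop (𝓝 (1 - 1 / C)) := by
  have hlim := ((tendsto_mul_sub_div C lam c).inv₀ (mul_ne_zero hC hlam.ne')).const_mul lam
  have hvalue : lam * (C * lam)⁻¹ = 1 / C := by field_simp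
  rw [hvalue] at hlim
  exact hlim.const_sub 1

lemma tendsto_one_sub_div_pow_sub (c d : ℝ) :
    Tendsto (fun n : ℕ => (1 - c / n) ^ n - 1 / (d * n)) atTop (𝓝 (Real.exp (-c))) := by
  have hpow : Tendsto (fun n : ℕ => (1 - c / n) ^ n) atTop (𝓝 (Real.exp (-c))) := by
    simpa only [neg_div, ← sub_eq_add_neg] using Real.tendsto_one_add_div_pow_exp (-c)
  simpa only [div_div, sub_zero] using hpow.sub (tendsto_const_div_atTop_nhds_zero_nat (1 / d))

theorem tendsto_card_compl_atTop (hBI : ∀ m, 1 ≤ m → BasicIndependence (P m) (p m) (I₀ m))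
    (hg : ∀ m, 1 ≤ m → Measurable (g m)) (hα : 0 < α) (hlam₀ : 0 < lam) (hlam₁ : lam ≤ 1)
    (hC : 1 < C)
    (hG : Tendsto (fun m => (P m).real {ω | (fun i => p m i ω) ∈ conservativeSet α lam (g m) C})
      atTop (𝓝 1))
    (hV : Tendsto
      (fun m => (P m).real {ω | numFalseRej α lam (g m) (I₀ m) (fun i => p m i ω) = 0})
      atTop (𝓝 0)) :
    Tendsto (fun m => (I₀ m)ᶜ.card) atTop atTop := by
  refine tendsto_atTop.2 fun k => ?_
  by_contra hnot
  let l : Filter ℕ := atTop ⊓ 𝓟 {m | (I₀ m)ᶜ.card ≤ k}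
  have hl : l ≤ atTop := inf_le_left
  have : l.NeBot := frequently_mem_iff_neBot.1
    ((not_eventually.1 hnot).mono fun m hm => (not_le.1 hm).le)
  have hk : ∀ᶠ m in l, (I₀ m)ᶜ.card ≤ k := mem_inf_of_right (mem_principal_self _)
  have hn : Tendsto (fun m => (I₀ m).card) l atTop := by
    refine tendsto_atTop_mono' l ?_ ((tendsto_sub_atTop_nat k).mono_left hl)
    filter_upwards [hk] with m hm
    have := Finset.card_add_card_compl (I₀ m)
    rw [Fintype.card_fin] at this
    omega
  have hC₀ : 0 < C := by positivity
  have hfactor := (tendsto_one_sub_div_mul_sub_div hlam₀ hC₀.ne' (2 * k)).comp hn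
  have hlower := hfactor.mul (((tendsto_one_sub_div_pow_sub (2 * k) (lam ^ 2)).comp hn).sub
    ((hG.mono_left hl).const_sub 1))
  have hlim : 0 < 1 - 1 / C := sub_pos.2 ((div_lt_one hC₀).2 hC)
  have hle := le_of_tendsto_of_tendsto hlower (hV.mono_left hl) <| by
    filter_upwards [hk, hl (eventually_ge_atTop 1), hn.eventually_ge_atTop 1,
      hn.eventually ((tendsto_mul_sub_div C lam (2 * k)).eventually_const_le
        (lt_mul_of_one_lt_left hlam₀ hC))] with m hkm hm hnm hlamC
    exact (hBI m hm).le_measureReal_numFalseRej_eq_zero (Finset.card_pos.1 hnm) (hg m hm) hα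
      hlam₀ hlam₁ hC.le hkm hlamC
  rw [sub_self, sub_zero] at hle
  exact (mul_pos hlim (Real.exp_pos _)).not_ge hle

theorem not_tendsto_measureReal_numFalseRej_eq_zero_of_uniform
    (hBI : ∀ m, 1 ≤ m → BasicIndependence (P m) (p m) (I₀ m))
    (hg : ∀ m, 1 ≤ m → Measurable (g m)) (hα : 0 < α) (hlam₀ : 0 < lam) (hlam₁ : lam ≤ 1)
    (hC : 1 < C)
    (hG : Tendsto (fun m => (P m).real {ω | (fun i => p m i ω) ∈ conservativeSet α lam (g m) C})
      atTop (𝓝 1))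
    (hind : ∀ m, 1 ≤ m → iIndepFun (fun (i : {i // i ∈ (I₀ m)ᶜ}) => p m i) (P m))
    (hu : ∀ m, 1 ≤ m → ∀ i ∈ (I₀ m)ᶜ, pdf.IsUniform (p m i) (Icc 0 lam) (P m) volume) :
    ¬ Tendsto (fun m => (P m).real {ω | numFalseRej α lam (g m) (I₀ m) (fun i => p m i ω) = 0})
      atTop (𝓝 0) := by
  intro hV
  have hle : (1 - 1 / C) * 1 ≤ 0 := le_of_tendsto_of_tendsto (hG.const_mul _) hV <|
    (eventually_ge_atTop 1).mono fun m hm =>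
      (hBI m hm).le_measureReal_numFalseRej_eq_zero_of_uniform (hg m hm) hα hlam₀ hlam₁ hC.le
        (hind m hm) (hu m hm)
  linarith [(div_lt_one (by positivity)).2 hC]

end Asymptotics

end AdaptiveStepUp

theorem theorem5p1_general {Ω : ℕ → Type*} [∀ m, MeasurableSpace (Ω m)]
    (P : ∀ m, Measure (Ω m)) [∀ m, IsProbabilityMeasure (P m)]
    (p : ∀ m, Fin m → Ω m → ℝ) (I₀ : ∀ m, Finset (Fin m))
    (hBI : ∀ m, 1 ≤ m → BasicIndependence (P m) (p m) (I₀ m))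
    (α lam : ℝ) (hα : 0 < α) (hlam₀ : 0 < lam) (hlam₁ : lam ≤ 1)
    (g : ℕ → (Set.Ici lam → ℝ) → ℝ) (hg : ∀ m, 1 ≤ m → Measurable (g m))
    (hFDR : 0 < liminf (fun m => fdr (P m) (p m) α lam (g m) (I₀ m)) atTop)
    (hA4 : ∃ C : ℝ, 1 < C ∧ Tendsto (fun m => P m {ω |
      C * α / lam * max (countLE (fun i => p m i ω) lam) 1 ≤
        estimate lam (g m) (fun i => p m i ω)}) atTop (𝓝 1)) :
    (Consistent P p α lam g I₀ → Tendsto (fun m => (I₀ m)ᶜ.card) atTop atTop) ∧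
    ((∀ m, 1 ≤ m → iIndepFun (fun (i : {i // i ∈ (I₀ m)ᶜ}) => p m i) (P m)) →
      (∀ m, 1 ≤ m → ∀ i ∈ (I₀ m)ᶜ,
        pdf.IsUniform (p m i) (Set.Icc 0 lam) (P m) volume) →
      ¬ Consistent P p α lam g I₀) := by
  obtain ⟨C, hC, hA4⟩ := hA4
  have hG : Tendsto (fun m =>
      (P m).real {ω | (fun i => p m i ω) ∈ conservativeSet α lam (g m) C}) atTop (𝓝 1) :=
    (ENNReal.tendsto_toReal ENNReal.one_ne_top).comp hA4
  exact ⟨fun hcons => tendsto_card_compl_atTop hBI hg hα hlam₀ hlam₁ hC hG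
      (hcons.tendsto_measureReal_numFalseRej_eq_zero hFDR),
    fun hind hu hcons => not_tendsto_measureReal_numFalseRej_eq_zero_of_uniform hBI hg hα hlam₀
      hlam₁ hC hG hind hu (hcons.tendsto_measureReal_numFalseRej_eq_zero hFDR)⟩

theorem theorem5p1 {Ω : ℕ → Type*} [∀ m, MeasurableSpace (Ω m)]
    (P : ∀ m, Measure (Ω m)) [∀ m, IsProbabilityMeasure (P m)]
    (p : ∀ m, Fin m → Ω m → ℝ) (I₀ : ∀ m, Finset (Fin m))
    (hBI : ∀ m, 1 ≤ m → BasicIndependence (P m) (p m) (I₀ m))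
    (hm₀ : ∀ m, 1 ≤ m → 1 ≤ (I₀ m).card)
    (α lam : ℝ) (hα₀ : 0 < α) (hα₁ : α < 1) (hαlam : α ≤ lam) (hlam : lam < 1)
    (g : ℕ → (Set.Ici lam → ℝ) → ℝ)
    (hg : ∀ m, 1 ≤ m → Measurable (g m))
    (hgpos : ∀ m, 1 ≤ m → ∀ ω, 0 < estimate lam (g m) (fun i => p m i ω))
    (hFDR : 0 < liminf (fun m => fdr (P m) (p m) α lam (g m) (I₀ m)) atTop)
    (hA4 : ∃ C : ℝ, 1 < C ∧ Tendsto (fun m => P m {ω |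
      C * α / lam * max (countLE (fun i => p m i ω) lam) 1 ≤
        estimate lam (g m) (fun i => p m i ω)}) atTop (𝓝 1)) :
    (Consistent P p α lam g I₀ → Tendsto (fun m => (I₀ m)ᶜ.card) atTop atTop) ∧
    (∀ κ₀ : ℝ, 0 < κ₀ → κ₀ ≤ 1 →
      Tendsto (fun m => ((I₀ m).card : ℝ) / (m : ℝ)) atTop (𝓝 κ₀) →
      (∀ m, 1 ≤ m → iIndepFun (fun (i : {i // i ∈ (I₀ m)ᶜ}) => p m i) (P m)) →
      (∀ m, 1 ≤ m → ∀ i ∈ (I₀ m)ᶜ,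
        pdf.IsUniform (p m i) (Set.Icc 0 lam) (P m) volume) →
      ¬ Consistent P p α lam g I₀) :=
  have h := theorem5p1_general P p I₀ hBI α lam hα₀ (hα₀.trans_le hαlam) hlam.le g hg hFDR hA4
  ⟨h.1, fun _ _ _ _ => h.2⟩
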